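/- Let $p\ge 0$ be an integer, let $\alpha_1,\dots,\alpha_p>-1$ be real numbers with $\alpha_i-\alpha_j\notin\mathbb Z$ for $i\ne j$, let $\vec n=(n_1,\dots,n_p)\in\mathbb N_0^p$ and $|\vec n|=n_1+\cdots+n_p$. Let $L_{\vec n}$ be the type II multiple Laguerre polynomial of the first kind, that is, the monic real polynomial of degree $|\vec n|$ such that $$\int_0^\infty x^j L_{\vec n}(x)\,e^{-x}x^{\alpha_i}\,dx=0,\qquad 0\le j\le n_i-1,\quad 1\le i\le p.$$ Let $\mathcal C$ be an anticlockwise contour enclosing $(-\infty,0]$ once: a piecewise $C^1$ curve $\gamma:\mathbb R\to\mathbb C\setminus(-\infty,0]$ with $\operatorname{Re}\gamma(t)\to-\infty$ as $t\to\pm\infty$, such that for every $r\in(-\infty,0]$, as soon as $-a$ and $b$ are large enough, the closed curve consisting of $\gamma|_{[a,b]}$ and the segment from $\gamma(b)$ to $\gamma(a)$ has winding number $1$ about $r$. Integrals over $\mathcal C$ are understood as improper integrals, $\int_{\mathcal C}f(s)\,ds=\lim_{a\to-\infty,\;b\to\infty}\int_a^b f(\gamma(t))\gamma'(t)\,dt$.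 Write $(a)_m=a(a+1)\cdots(a+m-1)$, $(a)_0=1$. Then for every $x>0$ $$L_{\vec n}(x)\,e^{-x}=(-1)^{|\vec n|}\int_{\mathcal C}\Gamma(s)\prod_{i=1}^p(\alpha_i+1-s)_{n_i}\,x^{-s}\,\frac{ds}{2\pi\mathrm i}$$ whenever the integral converges, and the integral does converge whenever $\mathcal C$ stays at a positive distance from $(-\infty,0]$. -/

import Mathlib

open MeasureTheory Filter Topology Polynomial

/-- `L` is a monic type II multiple Laguerre polynomial of the first kind: it is monic, of degree
`|n| = n₁ + ⋯ + n_p`, and orthogonal to `1, x, …, x ^ (nᵢ - 1)` for each of the weights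
`wᵢ(x) = e^{-x} x^{αᵢ}` on `[0, ∞)`. -/
def IsLaguerreTypeII {p : ℕ} (α : Fin p → ℝ) (n : Fin p → ℕ) (L : ℝ[X]) : Prop :=
  L.Monic ∧ L.natDegree = ∑ i, n i ∧
    ∀ i, ∀ j < n i,
      ∫ x in Set.Ici (0 : ℝ), x ^ j * L.eval x * (Real.exp (-x) * x ^ α i) = 0

/-- A (possibly unbounded) piecewise continuously differentiable curve `γ : ℝ → ℂ`: it is
continuous, and outside a locally finite set of break points it is `C¹`, up to the break points
(with one-sided derivatives there). -/
def IsPiecewiseC1 (γ : ℝ → ℂ) : Prop :=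
  Continuous γ ∧ ∃ B : Set ℝ, (∀ a b : ℝ, (B ∩ Set.Icc a b).Finite) ∧
    ∀ a b : ℝ, a < b → Disjoint B (Set.Ioo a b) → ContDiffOn ℝ 1 γ (Set.Icc a b)

/-- The (improper) contour integral of `f` along the whole curve `γ : ℝ → ℂ` converges to `I`. -/
def HasContourIntegral (γ : ℝ → ℂ) (f : ℂ → ℂ) (I : ℂ) : Prop :=
  (∀ a b : ℝ, IntervalIntegrable (fun t => f (γ t) * deriv γ t) volume a b) ∧
    Tendsto (fun q : ℝ × ℝ => ∫ t in q.1..q.2, f (γ t) * deriv γ t) (atBot ×ˢ atTop) (𝓝 I)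

/-- The winding number about `z` of the closed curve that runs along `γ` from `γ a` to `γ b` and
then back along the line segment from `γ b` to `γ a`. -/
noncomputable def closedWindingNumber (γ : ℝ → ℂ) (a b : ℝ) (z : ℂ) : ℂ :=
  (2 * Real.pi * Complex.I)⁻¹ *
    ((∫ t in a..b, (γ t - z)⁻¹ * deriv γ t) +
      ∫ u in (0 : ℝ)..1, (γ b + u * (γ a - γ b) - z)⁻¹ * (γ a - γ b))

/-- `γ` is an anticlockwise contour enclosing the half-line `(-∞, 0]` once: a piecewise `C¹` curve
that avoids `(-∞, 0]` (the slit plane is its complement), has both its ends at `-∞`, and winds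
exactly once, anticlockwise, about each point `r` of `(-∞, 0]`. As `γ` is closed only at infinity,
the latter refers to long finite pieces of `γ`, closed up by the segment between their end points
(which passes to the left of `r`). -/
def EnclosesNegHalfLineOnce (γ : ℝ → ℂ) : Prop :=
  IsPiecewiseC1 γ ∧ (∀ t, γ t ∈ Complex.slitPlane) ∧
    Tendsto (fun t => (γ t).re) atBot atBot ∧ Tendsto (fun t => (γ t).re) atTop atBot ∧
    ∀ r : ℝ, r ≤ 0 →
      ∀ᶠ q : ℝ × ℝ in atBot ×ˢ atTop, closedWindingNumber γ q.1 q.2 (r : ℂ) = 1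

/-- The integrand `Γ(s) ∏ᵢ (αᵢ + 1 - s)_{nᵢ} x^{-s} / (2πi)`, with `(a)_m` the rising factorial. -/
noncomputable def laguerreIntegrand {p : ℕ} (α : Fin p → ℝ) (n : Fin p → ℕ) (x : ℝ) (s : ℂ) : ℂ :=
  Complex.Gamma s * (∏ i, (ascPochhammer ℂ (n i)).eval ((α i : ℂ) + 1 - s)) * (x : ℂ) ^ (-s) /
    (2 * Real.pi * Complex.I)

/-! Replacing `X ^ m` by `(X)_m` in `L` gives a monic polynomial `P` of the same degree with `∫ x ^
j L e^{-x} x^β = P(β + 1 + j) Γ(β + 1 + j)`. Orthogonality thus prescribes `|n|` distinct zeros of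
`P`, so `P(s)` is, up to `(-1)^|n|`, the product of Pochhammer symbols in the integrand
(`toAscPochhammer_eq_prod`). As `(s)_m Γ(s) = Γ(s + m)`, the integrand is a combination of the
functions `x ^ m Γ(s + m) x^{-(s + m)}`, and everything reduces to `Γ(s) x^{-s}`
(`laguerreIntegrand_eq_sum`).

No contour is deformed. On the slit plane `Γ(s) x^{-s}` has a primitive `F`, so an integral along a
piece of `γ` is a difference of values of `F`. Mellin inversion on `Re s = 1` shows that `F` has
limits `c`, `c'` at `1 ± i∞` with `c - c' = 2πi e^{-x}`. The factorial decay of `Γ` to the left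
shows that `F` has the same limits as `Re s → -∞` in the upper and lower half planes, away from the
poles (`exists_primitive_Gamma_mul_cpow_neg`). The winding number forces `γ` to start below the cut
and to end above it (`EnclosesNegHalfLineOnce.eventually_im`), so the integral is the difference of
the two limits. -/

/-! ### Primitives on the slit plane -/

/-- The unit disc is mapped onto the slit plane by the square `k` of the Cayley transform, with
inverse `h`. A primitive `G` of the pulled-back form on the disc gives `G ∘ h`. -/
theorem exists_primitive_slitPlane {f : ℂ → ℂ} (hf : DifferentiableOn ℂ f Complex.slitPlane) :
    ∃ F : ℂ → ℂ, ∀ s ∈ Complex.slitPlane, HasDerivAt F (f s) s := by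
  set k : ℂ → ℂ := fun u => ((1 + u) / (1 - u)) ^ 2 with hk
  set h : ℂ → ℂ := fun s => (s ^ (1 / 2 : ℂ) - 1) / (s ^ (1 / 2 : ℂ) + 1) with hh
  have hne : ∀ u ∈ Metric.ball (0 : ℂ) 1, 1 - u ≠ 0 := by
    intro u hu h0
    have : u = 1 := (sub_eq_zero.1 h0).symm
    simp [this] at hu
  have hkd : DifferentiableOn ℂ k (Metric.ball 0 1) := by
    intro u hu
    have := hne u hu
    exact (((differentiableAt_const _).add differentiableAt_id).div
      ((differentiableAt_const _).sub differentiableAt_id) this).pow 2 |>.differentiableWithinAt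
  have hre : ∀ u ∈ Metric.ball (0 : ℂ) 1, 0 < ((1 + u) / (1 - u)).re := by
    intro u hu
    have h1 := hne u hu
    have hn : 0 < Complex.normSq (1 - u) := Complex.normSq_pos.2 h1
    have hu' : u.re * u.re + u.im * u.im < 1 := by
      have : ‖u‖ < 1 := by simpa using hu
      rw [← Complex.normSq_apply, Complex.normSq_eq_norm_sq]
      nlinarith [norm_nonneg u]
    rw [Complex.div_re, ← add_div]
    apply div_pos _ hn
    simp
    nlinarith
  have hmaps : Set.MapsTo k (Metric.ball 0 1) Complex.slitPlane := by
    intro u hu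
    have := hre u hu
    set w := (1 + u) / (1 - u)
    change w ^ 2 ∈ Complex.slitPlane
    rw [Complex.mem_slitPlane_iff]
    by_cases hw : w.im = 0
    · left; simp [pow_two, hw]; positivity
    · right
      have e : (w ^ 2).im = 2 * (w.re * w.im) := by rw [pow_two, Complex.mul_im]; ring
      rw [e]
      exact mul_ne_zero two_ne_zero (mul_ne_zero this.ne' hw)
  have hroot : ∀ s ∈ Complex.slitPlane, 0 < (s ^ (1 / 2 : ℂ)).re ∧ (s ^ (1 / 2 : ℂ)) ^ 2 = s := by
    intro s hs
    have hs0 := Complex.slitPlane_ne_zero hs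
    refine ⟨?_, ?_⟩
    · rw [Complex.cpow_def_of_ne_zero hs0, Complex.exp_re]
      apply mul_pos (Real.exp_pos _)
      apply Real.cos_pos_of_mem_Ioo
      have h1 := Complex.neg_pi_lt_arg s
      have h2 : s.arg < Real.pi := lt_of_le_of_ne (Complex.arg_le_pi s)
        (Complex.mem_slitPlane_iff_arg.1 hs).1
      have : (Complex.log s * (1 / 2)).im = s.arg / 2 := by
        rw [show (1 / 2 : ℂ) = ((1 / 2 : ℝ) : ℂ) by push_cast; rfl, Complex.im_mul_ofReal,
          Complex.log_im]; ring
      rw [this]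
      constructor <;> linarith
    · rw [← Complex.cpow_nat_mul]; norm_num
  have hwne : ∀ w : ℂ, 0 < w.re → w + 1 ≠ 0 := by
    intro w hw h0
    have := congrArg Complex.re h0
    simp at this; linarith
  have hball : Set.MapsTo h Complex.slitPlane (Metric.ball 0 1) := by
    intro s hs
    obtain ⟨h1, -⟩ := hroot s hs
    set w := s ^ (1 / 2 : ℂ) with hw
    have h2 := hwne w h1
    change (w - 1) / (w + 1) ∈ _
    rw [mem_ball_zero_iff, norm_div, div_lt_one (norm_pos_iff.2 h2)]
    apply lt_of_pow_lt_pow_left₀ 2 (norm_nonneg _)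
    rw [← Complex.normSq_eq_norm_sq, ← Complex.normSq_eq_norm_sq, Complex.normSq_apply,
      Complex.normSq_apply]
    simp; nlinarith
  have hkh : ∀ s ∈ Complex.slitPlane, k (h s) = s := by
    intro s hs
    obtain ⟨h1, h3⟩ := hroot s hs
    have h2 := hwne _ h1
    simp only [hk, hh]
    conv_rhs => rw [← h3]
    congr 1
    have : 1 - (s ^ (1 / 2 : ℂ) - 1) / (s ^ (1 / 2 : ℂ) + 1) ≠ 0 :=
      hne _ (hball hs)
    rw [div_eq_iff this]
    field_simp
    ring
  have hhd : ∀ s ∈ Complex.slitPlane, DifferentiableAt ℂ h s := by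
    intro s hs
    have h2 := hwne _ (hroot s hs).1
    have : DifferentiableAt ℂ (fun s : ℂ => s ^ (1 / 2 : ℂ)) s :=
      differentiableAt_id.cpow_const hs
    exact (this.sub_const _).div (this.add_const _) h2
  obtain ⟨G, hG⟩ := DifferentiableOn.isExactOn_ball (c := 0) (r := 1)
    (f := fun u => f (k u) * deriv k u)
    ((hf.comp hkd hmaps).mul (hkd.deriv Metric.isOpen_ball))
  refine ⟨G ∘ h, fun s hs => ?_⟩
  have e1 : HasDerivAt (G ∘ h) _ s := (hG _ (hball hs)).comp s (hhd s hs).hasDerivAt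
  have e2 : HasDerivAt (k ∘ h) (deriv k (h s) * deriv h s) s :=
    HasDerivAt.comp s (hkd.differentiableAt (Metric.isOpen_ball.mem_nhds (hball hs))).hasDerivAt
      (hhd s hs).hasDerivAt
  have e3 : HasDerivAt (k ∘ h) 1 s :=
    (hasDerivAt_id s).congr_of_eventuallyEq
      (eventually_of_mem (Complex.isOpen_slitPlane.mem_nhds hs) hkh)
  have e4 := e2.unique e3
  convert e1 using 1
  simp only [hkh s hs]
  rw [mul_assoc, e4, mul_one]

/-! ### Decay of the Gamma function to the left -/

theorem Complex.norm_Gamma_le_Gamma_re {z : ℂ} (hz : 0 < z.re) :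
    ‖Complex.Gamma z‖ ≤ Real.Gamma z.re := by
  rw [Complex.Gamma_eq_integral hz, Real.Gamma_eq_integral hz, Complex.GammaIntegral]
  refine (norm_integral_le_integral_norm _).trans (le_of_eq ?_)
  refine setIntegral_congr_fun measurableSet_Ioi fun t ht => ?_
  have ht : 0 < t := ht
  simp only [norm_mul]
  rw [Complex.norm_cpow_eq_rpow_re_of_pos ht, Complex.norm_of_nonneg (Real.exp_pos _).le]
  simp

theorem Complex.exists_norm_Gamma_le_of_re_mem_Icc :
    ∃ C : ℝ, 0 ≤ C ∧ ∀ z : ℂ, 2 ≤ z.re → z.re ≤ 4 → ‖Complex.Gamma z‖ ≤ C := by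
  have hc : ContinuousOn Real.Gamma (Set.Icc 2 4) := by
    intro r hr
    refine (Real.differentiableAt_Gamma fun m => ?_).continuousAt.continuousWithinAt
    have : (0 : ℝ) ≤ m := m.cast_nonneg
    have := hr.1
    linarith
  obtain ⟨C, hC⟩ := isCompact_Icc.exists_bound_of_continuousOn hc
  refine ⟨C, (norm_nonneg _).trans (hC 2 (by norm_num)), fun z h2 h4 => ?_⟩
  exact (Complex.norm_Gamma_le_Gamma_re (by linarith)).trans
    ((le_abs_self _).trans (hC _ ⟨h2, h4⟩))

theorem Complex.Gamma_add_nat_eq_prod_mul {z : ℂ} (K : ℕ) (hz : ∀ k : ℕ, z + k ≠ 0) :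
    Complex.Gamma (z + K) = (∏ k ∈ Finset.range K, (z + k)) * Complex.Gamma z := by
  induction K with
  | zero => simp
  | succ K ih =>
    rw [Finset.prod_range_succ, Nat.cast_succ, ← add_assoc, Complex.Gamma_add_one _ (hz K), ih]
    ring

theorem factorial_le_prod_norm_add {z : ℂ} (N : ℕ) (h : N ≤ -z.re) :
    (N.factorial : ℝ) ≤ ∏ k ∈ Finset.range N, ‖z + k‖ := by
  rw [← Finset.prod_range_add_one_eq_factorial, ← Finset.prod_range_reflect, Nat.cast_prod]
  refine Finset.prod_le_prod (fun _ _ => Nat.cast_nonneg _) fun k hk => ?_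
  have hk := Finset.mem_range.1 hk
  have e : ((N - 1 - k + 1 : ℕ) : ℝ) = N - k := by
    rw [show N - 1 - k + 1 = N - k by omega, Nat.cast_sub hk.le]
  rw [e]
  refine le_trans ?_ ((neg_le_abs _).trans (Complex.abs_re_le_norm _))
  simp; linarith

/-- The functional equation shifts `z` by `N + 3` into the strip `2 ≤ Re ≤ 4`, where `Γ` is bounded.
Of the factors divided out, the first `N` contribute `N!`, the next two `δ ^ 2 (1 + y ^ 2) / 2`, and
the last at least `1`. -/
theorem Complex.exists_norm_Gamma_le :
    ∃ C : ℝ, 0 ≤ C ∧ ∀ (z : ℂ) (δ : ℝ), z.re ≤ 1 → 0 < δ → δ ≤ 1 → (∀ k : ℕ, δ ≤ ‖z + k‖) →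
      ‖Complex.Gamma z‖ ≤ C / ((⌊-z.re⌋₊).factorial * δ ^ 2) * (1 + z.im ^ 2)⁻¹ := by
  obtain ⟨C, hC0, hC⟩ := Complex.exists_norm_Gamma_le_of_re_mem_Icc
  refine ⟨2 * C, by positivity, fun z δ hz1 hδ hδ1 hk => ?_⟩
  set N := ⌊-z.re⌋₊ with hN
  have hne : ∀ k : ℕ, z + k ≠ 0 := fun k h0 => by
    have := hk k
    rw [h0, norm_zero] at this
    linarith
  -- The natural floor is `0` when `0 < z.re ≤ 1`; in every case `-1 < z.re + N ≤ 1`.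
  have hlt : -z.re < N + 1 := Nat.lt_floor_add_one _
  have hfac : (N.factorial : ℝ) ≤ ∏ k ∈ Finset.range N, ‖z + k‖ := by
    rcases Nat.eq_zero_or_pos N with h0 | h0
    · simp [h0]
    · exact factorial_le_prod_norm_add N (Nat.floor_le (by
        by_contra hcon
        rw [hN, Nat.floor_of_nonpos (by linarith)] at h0
        omega))
  have hN1 : (N : ℝ) + z.re ≤ 1 := by
    rcases le_total 0 (-z.re) with h0 | h0
    · have := Nat.floor_le h0
      linarith
    · rw [hN, Nat.floor_of_nonpos h0]; simpa using hz1
  have hre : (z + ((N + 3 : ℕ) : ℂ)).re = z.re + N + 3 := by simp; ring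
  have hG := hC (z + ((N + 3 : ℕ) : ℂ)) (by rw [hre]; linarith) (by rw [hre]; linarith)
  rw [Complex.Gamma_add_nat_eq_prod_mul _ hne, norm_mul, norm_prod, Finset.prod_range_succ,
    Finset.prod_range_succ, Finset.prod_range_succ] at hG
  have him : ∀ k : ℕ, z.im ^ 2 ≤ ‖z + k‖ ^ 2 := fun k => by
    have := Complex.abs_im_le_norm (z + k)
    rw [← sq_abs z.im]
    simp at this
    gcongr
  have hlast : 1 ≤ ‖z + ((N + 2 : ℕ) : ℂ)‖ := by
    refine le_trans ?_ ((le_abs_self _).trans (Complex.abs_re_le_norm _))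
    simp; linarith
  have hpair : δ ^ 2 * (1 + z.im ^ 2) / 2 ≤ ‖z + (N : ℂ)‖ * ‖z + ((N + 1 : ℕ) : ℂ)‖ := by
    -- Average of the bounds `δ ^ 2` and `y ^ 2` for the squared norm, using `δ ≤ 1`.
    have hsq : ∀ k : ℕ, δ ^ 2 * (1 + z.im ^ 2) / 2 ≤ ‖z + k‖ ^ 2 := fun k => by
      have h1 := him k
      have h2 : δ ^ 2 ≤ ‖z + k‖ ^ 2 := pow_le_pow_left₀ hδ.le (hk k) 2
      have h3 : δ ^ 2 * z.im ^ 2 ≤ z.im ^ 2 :=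
        mul_le_of_le_one_left (sq_nonneg _) (pow_le_one₀ hδ.le hδ1)
      linarith
    rcases le_total ‖z + (N : ℂ)‖ ‖z + ((N + 1 : ℕ) : ℂ)‖ with h | h
    · exact (hsq N).trans (by rw [pow_two]; gcongr)
    · exact (hsq (N + 1)).trans (by rw [pow_two]; gcongr)
  have hP : N.factorial * (δ ^ 2 * (1 + z.im ^ 2) / 2) ≤
      (∏ k ∈ Finset.range N, ‖z + k‖) * ‖z + (N : ℂ)‖ * ‖z + ((N + 1 : ℕ) : ℂ)‖ *
        ‖z + ((N + 2 : ℕ) : ℂ)‖ := by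
    calc _ ≤ (∏ k ∈ Finset.range N, ‖z + k‖) * (‖z + (N : ℂ)‖ * ‖z + ((N + 1 : ℕ) : ℂ)‖) := by
          gcongr
      _ = (∏ k ∈ Finset.range N, ‖z + k‖) * ‖z + (N : ℂ)‖ * ‖z + ((N + 1 : ℕ) : ℂ)‖ * 1 := by ring
      _ ≤ _ := by gcongr
  have hpos : (0 : ℝ) < N.factorial * (δ ^ 2 * (1 + z.im ^ 2) / 2) := by positivity
  have h2 : N.factorial * (δ ^ 2 * (1 + z.im ^ 2) / 2) * ‖Complex.Gamma z‖ ≤ C :=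
    (mul_le_mul_of_nonneg_right hP (norm_nonneg _)).trans hG
  have : ‖Complex.Gamma z‖ ≤ C / (N.factorial * (δ ^ 2 * (1 + z.im ^ 2) / 2)) := by
    rw [le_div_iff₀ hpos]; linarith
  refine this.trans (le_of_eq ?_)
  field_simp

/-! ### Mellin inversion on the line `Re s = 1` -/

theorem Complex.norm_ofReal_cpow_neg {x : ℝ} (hx : 0 < x) (s : ℂ) :
    ‖(x : ℂ) ^ (-s)‖ = x ^ (-s.re) := by
  rw [Complex.norm_cpow_eq_rpow_re_of_pos hx, Complex.neg_re]

theorem differentiableOn_Gamma_mul_cpow_neg {x : ℝ} (hx : 0 < x) :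
    DifferentiableOn ℂ (fun s => Complex.Gamma s * (x : ℂ) ^ (-s)) Complex.slitPlane := by
  intro s hs
  have h1 : DifferentiableAt ℂ Complex.Gamma s := Complex.differentiableAt_Gamma s fun m hm => by
    rw [hm, Complex.mem_slitPlane_iff] at hs
    have : (0 : ℝ) ≤ m := m.cast_nonneg
    simp at hs
    linarith
  have h2 : DifferentiableAt ℂ (fun s : ℂ => (x : ℂ) ^ (-s)) s :=
    (differentiableAt_id.neg).const_cpow (Or.inl (by exact_mod_cast hx.ne'))
  exact (h1.mul h2).differentiableWithinAt

theorem one_add_mul_I_mem_slitPlane (y : ℝ) : (1 + y * Complex.I : ℂ) ∈ Complex.slitPlane := by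
  left; simp

theorem sub_eq_integral_vertical {f F : ℂ → ℂ} (hf : ContinuousOn f Complex.slitPlane)
    (hF : ∀ s ∈ Complex.slitPlane, HasDerivAt F (f s) s) (c : ℂ) (a b : ℝ)
    (hc : ∀ y ∈ Set.uIcc a b, c + y * Complex.I ∈ Complex.slitPlane) :
    F (c + b * Complex.I) - F (c + a * Complex.I) =
      ∫ y in a..b, f (c + y * Complex.I) * Complex.I := by
  have hl : ∀ y : ℝ, HasDerivAt (fun y : ℝ => c + y * Complex.I) Complex.I y := fun y => by
    exact (((Complex.ofRealCLM.hasDerivAt (x := y)).mul_const Complex.I).const_add c).congr_deriv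
      (by simp)
  rw [intervalIntegral.integral_eq_sub_of_hasDerivAt
    (f := fun y : ℝ => F (c + y * Complex.I))]
  · intro y hy
    exact (hF _ (hc y hy)).comp y (hl y)
  · refine ContinuousOn.intervalIntegrable ?_
    exact (hf.comp (by fun_prop) hc).mul continuousOn_const

theorem integrable_Gamma_mul_cpow_neg_vertical {x : ℝ} (hx : 0 < x) :
    Integrable fun y : ℝ => Complex.Gamma (1 + y * Complex.I) *
      (x : ℂ) ^ (-(1 + y * Complex.I : ℂ)) := by
  obtain ⟨C, -, hC⟩ := Complex.exists_norm_Gamma_le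
  have hcont : Continuous fun y : ℝ => Complex.Gamma (1 + y * Complex.I) *
      (x : ℂ) ^ (-(1 + y * Complex.I : ℂ)) :=
    (differentiableOn_Gamma_mul_cpow_neg hx).continuousOn.comp_continuous (by fun_prop)
      one_add_mul_I_mem_slitPlane
  refine (integrable_inv_one_add_sq.const_mul (C * x ^ (-1 : ℝ))).mono' hcont.aestronglyMeasurable
    (Eventually.of_forall fun y => ?_)
  have h := hC (1 + y * Complex.I) 1 (by simp) one_pos le_rfl fun k => by
    refine le_trans ?_ ((le_abs_self _).trans (Complex.abs_re_le_norm _))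
    simp
  rw [norm_mul, Complex.norm_ofReal_cpow_neg hx]
  have e1 : (1 + y * Complex.I : ℂ).re = 1 := by simp
  have e2 : (1 + y * Complex.I : ℂ).im = y := by simp
  rw [e1, e2] at h
  rw [e1]
  have e3 : ⌊(-1 : ℝ)⌋₊ = 0 := Nat.floor_of_nonpos (by norm_num)
  rw [e3] at h
  simp only [Nat.factorial_zero, Nat.cast_one, one_pow, mul_one, div_one] at h
  calc _ ≤ C * (1 + y ^ 2)⁻¹ * x ^ (-1 : ℝ) := by gcongr
    _ = _ := by ring

theorem integral_Gamma_mul_cpow_neg_vertical {x : ℝ} (hx : 0 < x) :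
    ∫ y : ℝ, Complex.Gamma (1 + y * Complex.I) * (x : ℂ) ^ (-(1 + y * Complex.I : ℂ)) =
      2 * Real.pi * Real.exp (-x) := by
  have hmel : ∀ y : ℝ, mellin (fun t : ℝ => ((Real.exp (-t) : ℝ) : ℂ)) (1 + y * Complex.I) =
      Complex.Gamma (1 + y * Complex.I) := by
    intro y
    rw [Complex.Gamma_eq_integral (by simp), Complex.GammaIntegral_eq_mellin]
  have hconv : MellinConvergent (fun t : ℝ => ((Real.exp (-t) : ℝ) : ℂ)) ((1 : ℝ) : ℂ) := by
    have := Complex.GammaIntegral_convergent (s := ((1 : ℝ) : ℂ)) (by simp)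
    refine this.congr_fun (fun t _ => ?_) measurableSet_Ioi
    simp [mul_comm]
  have hvert : Complex.VerticalIntegrable (mellin fun t : ℝ => ((Real.exp (-t) : ℝ) : ℂ)) 1 := by
    have := integrable_Gamma_mul_cpow_neg_vertical one_pos
    refine this.congr (Eventually.of_forall fun y => ?_)
    simp only [Complex.ofReal_one, Complex.one_cpow, mul_one]
    exact (hmel y).symm
  have := mellinInv_mellin_eq 1 (fun t : ℝ => ((Real.exp (-t) : ℝ) : ℂ)) hx hconv hvert (by fun_prop)
  rw [mellinInv] at this
  simp only [Complex.ofReal_one, hmel, smul_eq_mul, Complex.real_smul] at this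
  have hpi : (Real.pi : ℂ) ≠ 0 := by exact_mod_cast Real.pi_ne_zero
  rw [← this]
  simp only [mul_comm (Complex.Gamma _)]
  generalize ∫ y : ℝ, (x : ℂ) ^ (-(1 + y * Complex.I : ℂ)) * _ = J
  push_cast
  field_simp

/-! ### Limits of the primitive of `Γ(s) x^{-s}` -/

theorem exists_tendsto_vertical {x : ℝ} (hx : 0 < x) {F : ℂ → ℂ}
    (hF : ∀ s ∈ Complex.slitPlane, HasDerivAt F (Complex.Gamma s * (x : ℂ) ^ (-s)) s) :
    ∃ c, Tendsto (fun R : ℝ => F (1 + R * Complex.I)) atTop (𝓝 c) := by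
  have hi := (integrable_Gamma_mul_cpow_neg_vertical hx).mul_const Complex.I
  refine ⟨F 1 + _, ((intervalIntegral_tendsto_integral_Ioi 0 hi.integrableOn
    tendsto_id).const_add (F 1)).congr fun R => ?_⟩
  have := sub_eq_integral_vertical (differentiableOn_Gamma_mul_cpow_neg hx).continuousOn hF 1 0 R
    fun y _ => one_add_mul_I_mem_slitPlane y
  simp only [id]
  rw [← this]
  simp

theorem sub_eq_of_tendsto_vertical {x : ℝ} (hx : 0 < x) {F : ℂ → ℂ}
    (hF : ∀ s ∈ Complex.slitPlane, HasDerivAt F (Complex.Gamma s * (x : ℂ) ^ (-s)) s) {c c' : ℂ}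
    (hc : Tendsto (fun R : ℝ => F (1 + R * Complex.I)) atTop (𝓝 c))
    (hc' : Tendsto (fun R : ℝ => F (1 - R * Complex.I)) atTop (𝓝 c')) :
    c - c' = 2 * Real.pi * Complex.I * Real.exp (-x) := by
  have hi := (integrable_Gamma_mul_cpow_neg_vertical hx).mul_const Complex.I
  have h1 := intervalIntegral_tendsto_integral hi tendsto_neg_atTop_atBot tendsto_id
  rw [integral_mul_const, integral_Gamma_mul_cpow_neg_vertical hx] at h1
  rw [tendsto_nhds_unique (hc.sub hc') (h1.congr fun R => ?_)]
  · ring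
  · have := sub_eq_integral_vertical (differentiableOn_Gamma_mul_cpow_neg hx).continuousOn hF 1
      (-R) R fun y _ => one_add_mul_I_mem_slitPlane y
    simp only [id]
    rw [← this]
    push_cast
    simp [sub_eq_add_neg]

theorem exists_norm_Gamma_mul_cpow_neg_le :
    ∃ C : ℝ, 0 ≤ C ∧ ∀ (x : ℝ) (s : ℂ) (δ : ℝ), 0 < x → s.re ≤ 1 → 0 < δ → δ ≤ 1 →
      (∀ k : ℕ, δ ≤ ‖s + k‖) → ‖Complex.Gamma s * (x : ℂ) ^ (-s)‖ ≤
        C / ((⌊-s.re⌋₊).factorial * δ ^ 2) * x ^ (-s.re) * (1 + s.im ^ 2)⁻¹ := by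
  obtain ⟨C, hC0, hC⟩ := Complex.exists_norm_Gamma_le
  refine ⟨C, hC0, fun x s δ hx hs hδ hδ1 hk => ?_⟩
  rw [norm_mul, Complex.norm_ofReal_cpow_neg hx]
  calc _ ≤ (C / ((⌊-s.re⌋₊).factorial * δ ^ 2) * (1 + s.im ^ 2)⁻¹) * x ^ (-s.re) := by
        gcongr; exact hC s δ hs hδ hδ1 hk
    _ = _ := by ring

theorem norm_le_norm_add_mul_I {z : ℂ} {y : ℝ} (hz : 0 ≤ z.im) (hy : 0 ≤ y) :
    ‖z‖ ≤ ‖z + y * Complex.I‖ := by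
  rw [Complex.norm_def, Complex.norm_def, Complex.normSq_apply, Complex.normSq_apply]
  apply Real.sqrt_le_sqrt
  simp
  nlinarith [mul_nonneg hz hy]

/-- Go from `s` straight up by `R`, then horizontally to `Re = 1`, and let `R → ∞`. Going up moves
away from the poles, so the vertical part keeps the bound at `s`, with `∫ (1 + y ^ 2)⁻¹ ≤ π / 2`;
the horizontal part vanishes in the limit. -/
theorem exists_norm_sub_le {x : ℝ} (hx : 0 < x) {F : ℂ → ℂ}
    (hF : ∀ s ∈ Complex.slitPlane, HasDerivAt F (Complex.Gamma s * (x : ℂ) ^ (-s)) s) {c : ℂ}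
    (hc : Tendsto (fun R : ℝ => F (1 + R * Complex.I)) atTop (𝓝 c)) :
    ∃ C : ℝ, 0 ≤ C ∧ ∀ (s : ℂ) (δ : ℝ), s.re ≤ 1 → 0 < s.im → 0 < δ → δ ≤ 1 →
      (∀ k : ℕ, δ ≤ ‖s + k‖) →
        ‖F s - c‖ ≤ C / ((⌊-s.re⌋₊).factorial * δ ^ 2) * x ^ (-s.re) := by
  obtain ⟨C, hC0, hC⟩ := exists_norm_Gamma_mul_cpow_neg_le
  refine ⟨C * (Real.pi / 2), by positivity, fun s δ hs1 him hδ hδ1 hk => ?_⟩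
  have hslit : ∀ y : ℝ, 0 ≤ y → s + y * Complex.I ∈ Complex.slitPlane := fun y hy => by
    right; simp; linarith
  set A := C / ((⌊-s.re⌋₊).factorial * δ ^ 2) * x ^ (-s.re) with hA
  have hA0 : 0 ≤ A := by positivity
  have hvert : ∀ R : ℝ, 0 ≤ R → ‖F (s + R * Complex.I) - F s‖ ≤ A * (Real.pi / 2) := by
    intro R hR
    have h1 := sub_eq_integral_vertical (differentiableOn_Gamma_mul_cpow_neg hx).continuousOn hF
      s 0 R fun y hy => hslit y (by rw [Set.uIcc_of_le hR] at hy; exact hy.1)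
    simp only [Complex.ofReal_zero, zero_mul, add_zero] at h1
    rw [h1]
    have hint : IntervalIntegrable (fun y : ℝ => A * (1 + y ^ 2)⁻¹) volume 0 R :=
      (integrable_inv_one_add_sq.const_mul A).intervalIntegrable
    refine (intervalIntegral.norm_integral_le_of_norm_le hR
      (Eventually.of_forall fun y hy => ?_) hint).trans ?_
    · rw [norm_mul, Complex.norm_I, mul_one]
      have hy0 : 0 ≤ y := hy.1.le
      refine (hC x (s + y * Complex.I) δ hx (by simpa using hs1) hδ hδ1 fun k => ?_).trans ?_
      · refine (hk k).trans ?_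
        rw [add_right_comm]
        exact norm_le_norm_add_mul_I (by simpa using him.le) hy0
      · have e1 : (s + y * Complex.I).re = s.re := by simp
        have e2 : (s + y * Complex.I).im = s.im + y := by simp
        rw [e1, e2]
        gcongr
        linarith
    · rw [intervalIntegral.integral_const_mul, integral_inv_one_add_sq, Real.arctan_zero, sub_zero]
      gcongr
      exact (Real.arctan_lt_pi_div_two R).le
  -- A bound for `x ^ (-r)` on the horizontal segment, independent of its height.
  set M := Real.exp (|Real.log x| * (1 + |s.re|)) with hM
  have hMx : ∀ r : ℝ, s.re ≤ r → r ≤ 1 → x ^ (-r) ≤ M := by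
    intro r h1 h2
    rw [Real.rpow_def_of_pos hx, hM]
    refine Real.exp_le_exp.2 ?_
    refine (le_abs_self _).trans ?_
    rw [abs_mul]
    refine mul_le_mul_of_nonneg_left ?_ (abs_nonneg _)
    rw [abs_neg, abs_le]
    constructor
    · linarith [neg_abs_le s.re]
    · linarith [abs_nonneg s.re]
  have hhor : ∀ R : ℝ, 1 ≤ R → ‖F (1 + (s.im + R : ℝ) * Complex.I) - F (s + R * Complex.I)‖ ≤
      C * M * (1 + R ^ 2)⁻¹ * (1 - s.re) := by
    intro R hR
    have hconv : Convex ℝ {z : ℂ | s.re ≤ z.re ∧ z.re ≤ 1 ∧ z.im = s.im + R} := by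
      intro z hz w hw a b ha hb hab
      obtain ⟨h1, h2, h3⟩ := hz
      obtain ⟨h4, h5, h6⟩ := hw
      refine ⟨?_, ?_, ?_⟩
      · simp; nlinarith
      · simp; nlinarith
      · simp [h3, h6]; rw [← add_mul, hab, one_mul]
    have := hconv.norm_image_sub_le_of_norm_hasDerivWithin_le (f := F)
      (C := C * M * (1 + R ^ 2)⁻¹) (x := s + R * Complex.I) (y := 1 + (s.im + R : ℝ) * Complex.I)
      (fun z hz => (hF z (by right; rw [hz.2.2]; linarith)).hasDerivWithinAt)
      (fun z hz => ?_) (by simpa using hs1) (by simpa using hs1)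
    · refine this.trans (le_of_eq ?_)
      congr 1
      have : (1 + (s.im + R : ℝ) * Complex.I - (s + R * Complex.I) : ℂ) = ((1 - s.re : ℝ) : ℂ) := by
        apply Complex.ext <;> simp
      rw [this, Complex.norm_of_nonneg (by linarith)]
    · refine (hC x z 1 hx hz.2.1 one_pos le_rfl fun k => ?_).trans ?_
      · refine le_trans ?_ ((le_abs_self _).trans (Complex.abs_im_le_norm _))
        simp [hz.2.2]; linarith
      · rw [hz.2.2]
        have hfac : (1 : ℝ) ≤ (⌊-z.re⌋₊).factorial := by
          exact_mod_cast Nat.one_le_iff_ne_zero.2 (Nat.factorial_ne_zero _)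
        gcongr
        · rw [one_pow, mul_one]
          exact div_le_self hC0 hfac
        · exact hMx _ hz.1 hz.2.1
        · linarith
  have hlim : Tendsto (fun R : ℝ => ‖F s - F (1 + (s.im + R : ℝ) * Complex.I)‖) atTop
      (𝓝 ‖F s - c‖) :=
    (tendsto_const_nhds.sub (hc.comp (tendsto_atTop_add_const_left _ _ tendsto_id))).norm
  have herr : Tendsto (fun R : ℝ => A * (Real.pi / 2) + C * M * (1 + R ^ 2)⁻¹ * (1 - s.re)) atTop
      (𝓝 (A * (Real.pi / 2) + C * M * 0 * (1 - s.re))) :=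
    (((tendsto_inv_atTop_zero.comp (tendsto_atTop_add_const_left _ _
      (tendsto_pow_atTop two_ne_zero))).const_mul _).mul_const _).const_add _
  have := le_of_tendsto_of_tendsto hlim herr (by
    filter_upwards [eventually_ge_atTop 1] with R hR
    calc _ = ‖(F (s + R * Complex.I) - F s) +
          (F (1 + (s.im + R : ℝ) * Complex.I) - F (s + R * Complex.I))‖ := by
          rw [← norm_neg]; congr 1; ring
      _ ≤ _ := (norm_add_le _ _).trans (add_le_add (hvert R (by linarith)) (hhor R hR)))
  refine this.trans (le_of_eq ?_)
  rw [hA]; ring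

/-- Neighbourhoods of the end at `-∞` of the upper half plane, at distance at least `δ` from the
poles of the Gamma function. -/
def gammaTail (δ : ℝ) : Filter ℂ :=
  comap Complex.re atBot ⊓ 𝓟 {s | 0 < s.im ∧ ∀ k : ℕ, δ ≤ ‖s + k‖}

theorem tendsto_gammaTail {x : ℝ} (hx : 0 < x) {F : ℂ → ℂ}
    (hF : ∀ s ∈ Complex.slitPlane, HasDerivAt F (Complex.Gamma s * (x : ℂ) ^ (-s)) s) {c : ℂ}
    (hc : Tendsto (fun R : ℝ => F (1 + R * Complex.I)) atTop (𝓝 c)) {δ : ℝ} (hδ : 0 < δ) :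
    Tendsto F (gammaTail δ) (𝓝 c) := by
  obtain ⟨C, hC0, hC⟩ := exists_norm_sub_le hx hF hc
  rw [tendsto_iff_norm_sub_tendsto_zero]
  set δ' := min δ 1 with hδ'
  have hδ'0 : 0 < δ' := lt_min hδ one_pos
  have hre : Tendsto (fun s : ℂ => s.re) (gammaTail δ) atBot := tendsto_comap.mono_left inf_le_left
  have hfl : Tendsto (fun s : ℂ => ⌊-s.re⌋₊) (gammaTail δ) atTop :=
    tendsto_nat_floor_atTop.comp (tendsto_neg_atBot_atTop.comp hre)
  have hz : Tendsto (fun s : ℂ => C / δ' ^ 2 * max 1 x *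
      (max 1 x ^ ⌊-s.re⌋₊ / (⌊-s.re⌋₊).factorial)) (gammaTail δ) (𝓝 (C / δ' ^ 2 * max 1 x * 0)) :=
    ((FloorSemiring.tendsto_pow_div_factorial_atTop (max 1 x)).comp hfl).const_mul _
  rw [mul_zero] at hz
  refine squeeze_zero' (Eventually.of_forall fun s => norm_nonneg _) ?_ hz
  have hmem : {s : ℂ | 0 < s.im ∧ ∀ k : ℕ, δ ≤ ‖s + k‖} ∈ gammaTail δ :=
    mem_inf_of_right (mem_principal_self _)
  filter_upwards [hmem, hre.eventually_le_atBot 0] with s hs hs0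
  refine (hC s δ' (by linarith) hs.1 hδ'0 (min_le_right _ _) fun k =>
    (min_le_left _ _).trans (hs.2 k)).trans ?_
  -- Integer exponents allow comparison with the factorial; the base `max 1 x` makes rounding up
  -- harmless also for `x < 1`.
  have h1 : x ^ (-s.re) ≤ max 1 x ^ (⌊-s.re⌋₊ + 1) := by
    calc x ^ (-s.re) ≤ max 1 x ^ (-s.re) :=
          Real.rpow_le_rpow hx.le (le_max_right _ _) (by linarith)
      _ ≤ max 1 x ^ ((⌊-s.re⌋₊ + 1 : ℕ) : ℝ) :=
          Real.rpow_le_rpow_of_exponent_le (le_max_left _ _) (by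
            push_cast; exact (Nat.lt_floor_add_one _).le)
      _ = _ := Real.rpow_natCast _ _
  calc _ ≤ C / ((⌊-s.re⌋₊).factorial * δ' ^ 2) * max 1 x ^ (⌊-s.re⌋₊ + 1) := by gcongr
    _ = _ := by rw [pow_succ]; field_simp; ring

theorem exists_primitive_Gamma_mul_cpow_neg {x : ℝ} (hx : 0 < x) :
    ∃ (F : ℂ → ℂ) (c c' : ℂ),
      (∀ s ∈ Complex.slitPlane, HasDerivAt F (Complex.Gamma s * (x : ℂ) ^ (-s)) s) ∧
      c - c' = 2 * Real.pi * Complex.I * Real.exp (-x) ∧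
      ∀ δ : ℝ, 0 < δ → Tendsto F (gammaTail δ) (𝓝 c) ∧
        Tendsto (fun s => F (starRingEnd ℂ s)) (gammaTail δ) (𝓝 c') := by
  obtain ⟨F, hF⟩ := exists_primitive_slitPlane (differentiableOn_Gamma_mul_cpow_neg hx)
  -- By Schwarz reflection the conjugated function is a primitive too, so the upper half plane
  -- results also cover the lower one.
  have hF' : ∀ s ∈ Complex.slitPlane,
      HasDerivAt (starRingEnd ℂ ∘ F ∘ starRingEnd ℂ) (Complex.Gamma s * (x : ℂ) ^ (-s)) s := by
    intro s hs
    have hs' : starRingEnd ℂ s ∈ Complex.slitPlane := by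
      rw [Complex.mem_slitPlane_iff] at hs ⊢
      simpa using hs
    have := (hF _ hs').conj_conj
    rw [Complex.conj_conj] at this
    refine this.congr_deriv ?_
    rw [map_mul, Complex.Gamma_conj, Complex.conj_conj, ← map_neg, Complex.cpow_conj,
      Complex.conj_ofReal, Complex.conj_conj]
    rw [Complex.arg_ofReal_of_nonneg hx.le]
    exact Real.pi_ne_zero.symm
  obtain ⟨c, hc⟩ := exists_tendsto_vertical hx hF
  obtain ⟨d, hd⟩ := exists_tendsto_vertical hx hF'
  refine ⟨F, c, starRingEnd ℂ d, hF, sub_eq_of_tendsto_vertical hx hF hc ?_, fun δ hδ =>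
    ⟨tendsto_gammaTail hx hF hc hδ, ?_⟩⟩
  · refine ((Complex.continuous_conj.tendsto d).comp hd).congr fun R => ?_
    simp [sub_eq_add_neg]
  · refine ((Complex.continuous_conj.tendsto d).comp (tendsto_gammaTail hx hF' hd hδ)).congr
      fun s => ?_
    simp

/-! ### Fundamental theorem of calculus along piecewise `C¹` curves -/

theorem IsPiecewiseC1.locallyIntegrable_deriv {γ : ℝ → ℂ} (h : IsPiecewiseC1 γ) :
    LocallyIntegrable (deriv γ) volume := by
  obtain ⟨-, B, hB, hγ⟩ := h
  have key : ∀ a b : ℝ, a < b → Disjoint B (Set.Ioo a b) → IntegrableOn (deriv γ) (Set.Ioo a b) := by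
    intro a b hab hd
    have h1 := (hγ a b hab hd).continuousOn_derivWithin (uniqueDiffOn_Icc hab) le_rfl
    refine (h1.integrableOn_Icc.mono_set Set.Ioo_subset_Icc_self).congr_fun ?_ measurableSet_Ioo
    intro t ht
    exact derivWithin_of_mem_nhds (Icc_mem_nhds ht.1 ht.2)
  -- Near `t` the only possible break point is `t` itself, so two one-sided `C¹` pieces suffice.
  intro t
  have hfin := (hB (t - 1) (t + 1)).subset
    (show (B ∩ Set.Icc (t - 1) (t + 1)) \ {t} ⊆ _ from Set.sdiff_subset)
  have hnhds : ((B ∩ Set.Icc (t - 1) (t + 1)) \ {t})ᶜ ∈ 𝓝 t :=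
    hfin.isClosed.isOpen_compl.mem_nhds (by simp)
  obtain ⟨ε, hε, hball⟩ := Metric.mem_nhds_iff.1 hnhds
  set η := min ε 1 with hη
  have hη0 : 0 < η := lt_min hε one_pos
  have hηε : η ≤ ε := min_le_left _ _
  have hη1 : η ≤ 1 := min_le_right _ _
  have hout : ∀ s, s ≠ t → |s - t| < η → s ∉ B := by
    intro s hst hs hsB
    have := hball (show s ∈ Metric.ball t ε by rw [Metric.mem_ball, Real.dist_eq]; linarith)
    rw [abs_lt] at hs
    exact this ⟨⟨hsB, by constructor <;> linarith⟩, hst⟩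
  refine ⟨Set.Ioo (t - η) (t + η), Ioo_mem_nhds (by linarith) (by linarith), ?_⟩
  have hl := key (t - η) t (by linarith) (Set.disjoint_right.2 fun s hs =>
    hout s hs.2.ne (by rw [abs_lt]; constructor <;> linarith [hs.1, hs.2]))
  have hr := key t (t + η) (by linarith) (Set.disjoint_right.2 fun s hs =>
    hout s hs.1.ne' (by rw [abs_lt]; constructor <;> linarith [hs.1, hs.2]))
  have hr' : IntegrableOn (deriv γ) (Set.Ico t (t + η)) :=
    by rwa [integrableOn_Ico_iff_integrableOn_Ioo]
  refine (hl.union hr').mono_set ?_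
  intro s hs
  rcases lt_or_ge s t with h | h
  · exact Or.inl ⟨hs.1, h⟩
  · exact Or.inr ⟨h, hs.2⟩

theorem IsPiecewiseC1.exists_countable_differentiableAt {γ : ℝ → ℂ} (h : IsPiecewiseC1 γ) :
    ∃ S : Set ℝ, S.Countable ∧ ∀ t ∉ S, DifferentiableAt ℝ γ t := by
  obtain ⟨-, B, hB, hγ⟩ := h
  have hBc : B.Countable := by
    have : B = ⋃ N : ℕ, B ∩ Set.Icc (-(N : ℝ)) N := by
      rw [← Set.inter_iUnion]
      refine (Set.inter_eq_left.2 fun t _ => ?_).symm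
      obtain ⟨N, hN⟩ := exists_nat_ge |t|
      exact Set.mem_iUnion.2 ⟨N, abs_le.1 hN⟩
    rw [this]
    exact Set.countable_iUnion fun N => (hB _ _).countable
  refine ⟨B, hBc, fun t ht => ?_⟩
  have hnhds : (B ∩ Set.Icc (t - 1) (t + 1))ᶜ ∈ 𝓝 t :=
    (hB _ _).isClosed.isOpen_compl.mem_nhds fun h => ht h.1
  obtain ⟨ε, hε, hball⟩ := Metric.mem_nhds_iff.1 hnhds
  set η := min ε 1 with hη
  have hη0 : 0 < η := lt_min hε one_pos
  have hηε : η ≤ ε := min_le_left _ _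
  have hη1 : η ≤ 1 := min_le_right _ _
  refine ((hγ (t - η) (t + η) (by linarith) (Set.disjoint_right.2 fun s hs hsB => ?_)
    ).differentiableOn one_ne_zero).differentiableAt (Icc_mem_nhds (by linarith) (by linarith))
  refine hball (show s ∈ Metric.ball t ε from ?_) ⟨hsB, by constructor <;> linarith [hs.1, hs.2]⟩
  rw [Metric.mem_ball, Real.dist_eq, abs_lt]
  constructor <;> linarith [hs.1, hs.2]

theorem IsPiecewiseC1.intervalIntegrable {γ : ℝ → ℂ} (h : IsPiecewiseC1 γ) {U : Set ℂ}
    (hU : ∀ t, γ t ∈ U) {f : ℂ → ℂ} (hf : ContinuousOn f U) (a b : ℝ) :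
    IntervalIntegrable (fun t => f (γ t) * deriv γ t) volume a b :=
  (intervalIntegrable_iff.2 ((h.locallyIntegrable_deriv.integrableOn_isCompact
    isCompact_uIcc).mono_set Set.uIoc_subset_uIcc)).continuousOn_mul
    ((hf.comp_continuous h.1 hU).continuousOn)

theorem IsPiecewiseC1.integral_eq_sub {γ : ℝ → ℂ} (h : IsPiecewiseC1 γ) {U : Set ℂ}
    (hU : ∀ t, γ t ∈ U) {f F : ℂ → ℂ} (hf : ContinuousOn f U)
    (hF : ∀ s ∈ U, HasDerivAt F (f s) s) (a b : ℝ) :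
    ∫ t in a..b, f (γ t) * deriv γ t = F (γ b) - F (γ a) := by
  obtain ⟨S, hS, hd⟩ := h.exists_countable_differentiableAt
  refine integral_eq_of_hasDerivAt_off_countable (F ∘ γ) _ hS ?_ ?_
    (h.intervalIntegrable hU hf a b)
  · exact fun t _ => ((hF _ (hU t)).continuousAt.comp h.1.continuousAt).continuousWithinAt
  · exact fun t ht => (hF _ (hU t)).comp t (hd t ht.2).hasDerivAt

/-! ### The winding number and the two ends of the contour -/

theorem Complex.log_neg_of_im_pos {z : ℂ} (h : 0 < z.im) :
    Complex.log (-z) = Complex.log z - Real.pi * Complex.I := by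
  rw [Complex.log, Complex.log, Complex.arg_neg_eq_arg_sub_pi_of_im_pos h, norm_neg]
  push_cast; ring

theorem Complex.log_neg_of_im_neg {z : ℂ} (h : z.im < 0) :
    Complex.log (-z) = Complex.log z + Real.pi * Complex.I := by
  rw [Complex.log, Complex.log, Complex.arg_neg_eq_arg_add_pi_of_im_neg h, norm_neg]
  push_cast; ring

/-- The principal logarithm is a primitive of `s⁻¹` along `γ`; on the closing segment, which lies in
the left half plane, `log (-s)` takes its place. -/
theorem closedWindingNumber_zero {γ : ℝ → ℂ} (h : IsPiecewiseC1 γ)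
    (hγ : ∀ t, γ t ∈ Complex.slitPlane) {a b : ℝ} (ha : (γ a).re < 0) (hb : (γ b).re < 0) :
    closedWindingNumber γ a b 0 = (2 * Real.pi * Complex.I)⁻¹ *
      ((Complex.log (γ b) - Complex.log (γ a)) +
        (Complex.log (-γ a) - Complex.log (-γ b))) := by
  have h1 := h.integral_eq_sub hγ (f := fun s => s⁻¹) (F := Complex.log)
    (fun s hs => (continuousAt_inv₀ (Complex.slitPlane_ne_zero hs)).continuousWithinAt)
    (fun s hs => Complex.hasDerivAt_log hs) a b
  have h2 : ∫ u in (0 : ℝ)..1, (γ b + u * (γ a - γ b))⁻¹ * (γ a - γ b) =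
      Complex.log (-γ a) - Complex.log (-γ b) := by
    have hmem : ∀ u ∈ Set.uIcc (0 : ℝ) 1, -(γ b + u * (γ a - γ b)) ∈ Complex.slitPlane := by
      intro u hu
      rw [Set.uIcc_of_le zero_le_one] at hu
      left
      have : (-(γ b + u * (γ a - γ b))).re = -((1 - u) * (γ b).re + u * (γ a).re) := by
        simp; ring
      rw [this]
      rcases eq_or_lt_of_le hu.1 with h | h
      · rw [← h]; linarith
      · nlinarith [hu.2]
    have hl : ∀ u : ℝ, HasDerivAt (fun u : ℝ => -(γ b + u * (γ a - γ b))) (-(γ a - γ b)) u := by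
      intro u
      exact (((Complex.ofRealCLM.hasDerivAt (x := u)).mul_const (γ a - γ b)).const_add
        (γ b)).neg.congr_deriv (by simp)
    rw [intervalIntegral.integral_eq_sub_of_hasDerivAt
      (f := fun u : ℝ => Complex.log (-(γ b + u * (γ a - γ b))))]
    · simp
    · intro u hu
      have := (Complex.hasDerivAt_log (hmem u hu)).scomp u (hl u)
      refine this.congr_deriv ?_
      rw [smul_eq_mul, inv_neg]; ring
    · refine ContinuousOn.intervalIntegrable fun u hu => ContinuousAt.continuousWithinAt ?_
      have := Complex.slitPlane_ne_zero (hmem u hu)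
      refine ContinuousAt.mul (ContinuousAt.inv₀ (by fun_prop) (neg_ne_zero.1 this)) (by fun_prop)
  simp only [closedWindingNumber, sub_zero, h1, h2]

theorem eventually_im_ne_zero_of_tendsto_re {γ : ℝ → ℂ} {l : Filter ℝ}
    (hγ : ∀ t, γ t ∈ Complex.slitPlane) (h : Tendsto (fun t => (γ t).re) l atBot) :
    ∀ᶠ t in l, (γ t).re < 0 ∧ (γ t).im ≠ 0 := by
  filter_upwards [h.eventually_lt_atBot 0] with t ht
  exact ⟨ht, (Complex.mem_slitPlane_iff.1 (hγ t)).resolve_left (by linarith)⟩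

theorem EnclosesNegHalfLineOnce.eventually_im {γ : ℝ → ℂ} (h : EnclosesNegHalfLineOnce γ) :
    (∀ᶠ t in atBot, (γ t).im < 0) ∧ ∀ᶠ t in atTop, 0 < (γ t).im := by
  obtain ⟨hp, hs, hbot, htop, hw⟩ := h
  have key : ∀ᶠ q : ℝ × ℝ in atBot ×ˢ atTop, (γ q.1).im < 0 ∧ 0 < (γ q.2).im := by
    filter_upwards [hw 0 le_rfl, (eventually_im_ne_zero_of_tendsto_re hs hbot).prod_mk
      (eventually_im_ne_zero_of_tendsto_re hs htop)] with q hq ⟨⟨ha, ha'⟩, hb, hb'⟩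
    rw [Complex.ofReal_zero, closedWindingNumber_zero hp hs ha hb] at hq
    have hpi : (2 * Real.pi * Complex.I : ℂ) ≠ 0 := Complex.two_pi_I_ne_zero
    rw [inv_mul_eq_one₀ hpi] at hq
    -- Ends on the same side of the cut would give winding number `0`, and ends in the reverse order
    -- `-1`.
    rcases lt_or_gt_of_ne ha' with h1 | h1 <;> rcases lt_or_gt_of_ne hb' with h2 | h2
    · rw [Complex.log_neg_of_im_neg h1, Complex.log_neg_of_im_neg h2] at hq
      exact absurd (hq.trans (by ring)) hpi
    · exact ⟨h1, h2⟩
    · rw [Complex.log_neg_of_im_pos h1, Complex.log_neg_of_im_neg h2] at hq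
      refine absurd ?_ hpi
      linear_combination (1 / 2) * hq
    · rw [Complex.log_neg_of_im_pos h1, Complex.log_neg_of_im_pos h2] at hq
      exact absurd (hq.trans (by ring)) hpi
  obtain ⟨p, hp', q, hq', hpq⟩ := Filter.eventually_prod_iff.1 key
  exact ⟨hp'.mono fun t ht => (hpq ht hq'.exists.choose_spec).1,
    hq'.mono fun t ht => (hpq hp'.exists.choose_spec ht).2⟩

/-! ### Orthogonality determines the product of Pochhammer symbols -/

theorem Real.Gamma_add_nat_eq_ascPochhammer_mul {s : ℝ} (hs : 0 < s) (m : ℕ) :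
    Real.Gamma (s + m) = (ascPochhammer ℝ m).eval s * Real.Gamma s := by
  induction m with
  | zero => simp
  | succ m ih =>
    rw [Nat.cast_succ, ← add_assoc, Real.Gamma_add_one (by positivity), ih,
      ascPochhammer_succ_right]
    simp; ring

theorem Complex.Gamma_add_nat_eq_ascPochhammer_mul {s : ℂ} (hs : ∀ k : ℕ, s + k ≠ 0) (m : ℕ) :
    Complex.Gamma (s + m) = (ascPochhammer ℂ m).eval s * Complex.Gamma s := by
  induction m with
  | zero => simp
  | succ m ih =>
    rw [Nat.cast_succ, ← add_assoc, Complex.Gamma_add_one _ (hs m), ih,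
      ascPochhammer_succ_right]
    simp; ring

/-- The linear map that sends `X ^ m` to the rising factorial polynomial `(X)_m`. -/
noncomputable def toAscPochhammer (L : ℝ[X]) : ℝ[X] :=
  L.sum fun m a => C a * ascPochhammer ℝ m

theorem integral_pow_mul_eval_mul_exp_mul_rpow (L : ℝ[X]) (j : ℕ) {β : ℝ} (hβ : -1 < β) :
    ∫ x in Set.Ici (0 : ℝ), x ^ j * L.eval x * (Real.exp (-x) * x ^ β) =
      (toAscPochhammer L).eval (β + 1 + j) * Real.Gamma (β + 1 + j) := by
  have hs : 0 < β + 1 + j := by have : (0 : ℝ) ≤ j := j.cast_nonneg; linarith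
  have hs' : ∀ m : ℕ, 0 < β + 1 + j + m := fun m => by positivity
  rw [integral_Ici_eq_integral_Ioi]
  have h1 : ∀ x ∈ Set.Ioi (0 : ℝ), x ^ j * L.eval x * (Real.exp (-x) * x ^ β) =
      ∑ m ∈ L.support, L.coeff m * (Real.exp (-x) * x ^ (β + 1 + j + m - 1)) := by
    intro x hx
    have hx : 0 < x := hx
    rw [eval_eq_sum, Polynomial.sum, Finset.mul_sum, Finset.sum_mul]
    refine Finset.sum_congr rfl fun m _ => ?_
    rw [show β + 1 + j + m - 1 = β + j + m by ring, Real.rpow_add hx, Real.rpow_add hx,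
      Real.rpow_natCast, Real.rpow_natCast]
    ring
  rw [setIntegral_congr_fun measurableSet_Ioi h1, integral_finsetSum]
  · simp_rw [integral_const_mul, ← Real.Gamma_eq_integral (hs' _),
      Real.Gamma_add_nat_eq_ascPochhammer_mul hs]
    rw [toAscPochhammer, Polynomial.sum, eval_finsetSum, Finset.sum_mul]
    refine Finset.sum_congr rfl fun m _ => ?_
    simp; ring
  · exact fun m _ => (Real.GammaIntegral_convergent (hs' m)).const_mul _

theorem toAscPochhammer_monic {L : ℝ[X]} (hL : L.Monic) :
    (toAscPochhammer L).Monic ∧ (toAscPochhammer L).natDegree = L.natDegree := by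
  have hdeg : (ascPochhammer ℝ L.natDegree).natDegree = L.natDegree := ascPochhammer_natDegree _ _
  have hm : (ascPochhammer ℝ L.natDegree).Monic := monic_ascPochhammer _ _
  have e : toAscPochhammer L = ascPochhammer ℝ L.natDegree +
      ∑ m ∈ Finset.range L.natDegree, C (L.coeff m) * ascPochhammer ℝ m := by
    rw [toAscPochhammer, sum_over_range _ (by simp), Finset.sum_range_succ, hL.coeff_natDegree]
    simp [add_comm]
  have hlt : (∑ m ∈ Finset.range L.natDegree, C (L.coeff m) * ascPochhammer ℝ m).degree <
      (ascPochhammer ℝ L.natDegree).degree := by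
    rw [degree_eq_natDegree hm.ne_zero, hdeg]
    refine (degree_sum_le _ _).trans_lt ((Finset.sup_lt_iff (WithBot.bot_lt_coe _)).2 fun m hm => ?_)
    refine (degree_mul_le _ _).trans_lt ((add_le_add_left degree_C_le _).trans_lt ?_)
    rw [zero_add, degree_eq_natDegree (monic_ascPochhammer ℝ m).ne_zero, ascPochhammer_natDegree]
    exact_mod_cast Finset.mem_range.1 hm
  rw [e]
  exact ⟨hm.add_of_left hlt, by rw [natDegree_add_eq_left_of_degree_lt hlt, hdeg]⟩

theorem toAscPochhammer_eq_prod {p : ℕ} {α : Fin p → ℝ} (hα : ∀ i, -1 < α i)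
    (hα' : ∀ i j, i ≠ j → ∀ k : ℤ, α i - α j ≠ k) {n : Fin p → ℕ} {L : ℝ[X]}
    (hL : IsLaguerreTypeII α n L) :
    toAscPochhammer L = ∏ i, ∏ j ∈ Finset.range (n i), (X - C (α i + 1 + j)) := by
  obtain ⟨hmon, hdeg, horth⟩ := hL
  obtain ⟨h1, h2⟩ := toAscPochhammer_monic hmon
  have hroot : ∀ i, ∀ j < n i, (toAscPochhammer L).eval (α i + 1 + j) = 0 := by
    intro i j hj
    have := horth i j hj
    rw [integral_pow_mul_eval_mul_exp_mul_rpow L j (hα i)] at this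
    refine (mul_eq_zero.1 this).resolve_right (Real.Gamma_pos_of_pos ?_).ne'
    have : (0 : ℝ) ≤ j := j.cast_nonneg
    linarith [hα i]
  rw [Finset.prod_sigma']
  -- The nodes `α i + 1 + j` are distinct because no `α i - α j` with `i ≠ j` is an integer.
  have hinj : Set.InjOn (fun q : (_ : Fin p) × ℕ => α q.1 + 1 + q.2)
      (Finset.univ.sigma fun i => Finset.range (n i)) := by
    rintro ⟨i, j⟩ - ⟨i', j'⟩ - h
    simp only at h
    have hi : i = i' := by
      by_contra hne
      refine hα' i i' hne ((j' : ℤ) - j) ?_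
      push_cast; linarith
    subst hi
    have : j = j' := by exact_mod_cast (add_left_cancel h : (j : ℝ) = j')
    rw [this]
  have hmon' : (∏ q ∈ Finset.univ.sigma fun i => Finset.range (n i),
      (X - C (α q.1 + 1 + (q.2 : ℝ)))).Monic :=
    monic_prod_of_monic _ _ fun q _ => monic_X_sub_C _
  have hcard : (Finset.univ.sigma fun i => Finset.range (n i)).card = ∑ i, n i := by
    simp [Finset.card_sigma]
  have hdeg' : (∏ q ∈ Finset.univ.sigma fun i => Finset.range (n i),
      (X - C (α q.1 + 1 + (q.2 : ℝ)))).natDegree = ∑ i, n i := by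
    rw [natDegree_prod_of_monic _ _ fun q _ => monic_X_sub_C _]
    simp only [natDegree_X_sub_C, Finset.sum_const, hcard, smul_eq_mul, mul_one]
  -- Two monic polynomials of degree `|n|` differ by one of lower degree, which cannot have `|n|`
  -- zeros unless it vanishes.
  refine eq_of_degree_sub_lt_of_eval_finset_eq
    ((Finset.univ.sigma fun i => Finset.range (n i)).image fun q => α q.1 + 1 + (q.2 : ℝ)) ?_ ?_
  · rw [Finset.card_image_of_injOn hinj, hcard]
    have hd : (toAscPochhammer L).degree = ((∑ i, n i : ℕ) : WithBot ℕ) := by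
      rw [degree_eq_natDegree h1.ne_zero, h2, hdeg]
    rw [← hd]
    refine degree_sub_lt_left ?_ h1.ne_zero (by rw [h1.leadingCoeff, hmon'.leadingCoeff])
    rw [hd, degree_eq_natDegree hmon'.ne_zero, hdeg']
  · intro t ht
    obtain ⟨q, hq, rfl⟩ := Finset.mem_image.1 ht
    rw [hroot q.1 q.2 (by simpa using hq), eval_prod, eq_comm]
    exact Finset.prod_eq_zero hq (by simp)

theorem ascPochhammer_eval_eq_prod (m : ℕ) (z : ℂ) :
    (ascPochhammer ℂ m).eval z = ∏ j ∈ Finset.range m, (z + j) := by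
  induction m with
  | zero => simp
  | succ m ih => rw [ascPochhammer_succ_right, Finset.prod_range_succ, ← ih]; simp

/-! ### Reduction of the integrand to shifts of `Γ(s) x^{-s}` -/

theorem laguerreIntegrand_eq_sum {p : ℕ} {α : Fin p → ℝ} (hα : ∀ i, -1 < α i)
    (hα' : ∀ i j, i ≠ j → ∀ k : ℤ, α i - α j ≠ k) {n : Fin p → ℕ} {L : ℝ[X]}
    (hL : IsLaguerreTypeII α n L) {x : ℝ} (hx : 0 < x) {s : ℂ} (hs : s ∈ Complex.slitPlane) :
    laguerreIntegrand α n x s = (-1) ^ (∑ i, n i) / (2 * Real.pi * Complex.I) *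
      ∑ m ∈ L.support, (L.coeff m * (x : ℂ) ^ m) *
        (Complex.Gamma (s + m) * (x : ℂ) ^ (-(s + m))) := by
  have hx0 : (x : ℂ) ≠ 0 := by exact_mod_cast hx.ne'
  have hne : ∀ k : ℕ, s + k ≠ 0 := fun k h => by
    rw [eq_neg_of_add_eq_zero_left h, Complex.mem_slitPlane_iff] at hs
    have : (0 : ℝ) ≤ k := k.cast_nonneg
    simp at hs
    linarith
  have h1 : ∏ i, (ascPochhammer ℂ (n i)).eval ((α i : ℂ) + 1 - s) =
      (-1) ^ (∑ i, n i) * ((toAscPochhammer L).map (algebraMap ℝ ℂ)).eval s := by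
    rw [toAscPochhammer_eq_prod hα hα' hL, ← Finset.prod_pow_eq_pow_sum]
    simp only [Polynomial.map_prod, eval_prod, ← Finset.prod_mul_distrib]
    refine Finset.prod_congr rfl fun i _ => ?_
    rw [ascPochhammer_eval_eq_prod]
    conv_rhs => rw [← Finset.card_range (n i), ← Finset.prod_const, Finset.card_range,
      ← Finset.prod_mul_distrib]
    refine Finset.prod_congr rfl fun j _ => ?_
    simp; ring
  have h2 : ((toAscPochhammer L).map (algebraMap ℝ ℂ)).eval s * Complex.Gamma s =
      ∑ m ∈ L.support, L.coeff m * Complex.Gamma (s + m) := by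
    rw [toAscPochhammer, Polynomial.sum, Polynomial.map_sum, eval_finsetSum, Finset.sum_mul]
    refine Finset.sum_congr rfl fun m _ => ?_
    rw [Complex.Gamma_add_nat_eq_ascPochhammer_mul hne]
    simp [ascPochhammer_map]; ring
  have h3 : ∑ m ∈ L.support, (L.coeff m * (x : ℂ) ^ m) *
        (Complex.Gamma (s + m) * (x : ℂ) ^ (-(s + m))) =
      (∑ m ∈ L.support, L.coeff m * Complex.Gamma (s + m)) * (x : ℂ) ^ (-s) := by
    rw [Finset.sum_mul]
    refine Finset.sum_congr rfl fun m _ => ?_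
    rw [neg_add, Complex.cpow_add _ _ hx0, Complex.cpow_neg _ (m : ℂ), Complex.cpow_natCast]
    field_simp
  rw [laguerreIntegrand, h1, h3, ← h2]
  ring

theorem tendsto_gammaTail_iff {ι : Type*} {l : Filter ι} {g : ι → ℂ} {δ : ℝ} :
    Tendsto g l (gammaTail δ) ↔ Tendsto (fun t => (g t).re) l atBot ∧
      ∀ᶠ t in l, 0 < (g t).im ∧ ∀ k : ℕ, δ ≤ ‖g t + k‖ := by
  rw [gammaTail, tendsto_inf, tendsto_comap_iff, tendsto_principal]
  rfl

theorem tendsto_add_natCast_gammaTail (δ : ℝ) (m : ℕ) :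
    Tendsto (fun s : ℂ => s + m) (gammaTail δ) (gammaTail δ) := by
  obtain ⟨h1, h2⟩ := tendsto_gammaTail_iff.1 (tendsto_id (x := gammaTail δ))
  refine tendsto_gammaTail_iff.2 ⟨?_, ?_⟩
  · simpa using tendsto_atBot_add_const_right _ (m : ℝ) h1
  · filter_upwards [h2] with s hs
    refine ⟨by simpa using hs.1, fun k => ?_⟩
    have := hs.2 (m + k)
    rwa [Nat.cast_add, ← add_assoc] at this

theorem exists_primitive_laguerreIntegrand {p : ℕ} {α : Fin p → ℝ} (hα : ∀ i, -1 < α i)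
    (hα' : ∀ i j, i ≠ j → ∀ k : ℤ, α i - α j ≠ k) {n : Fin p → ℕ} {L : ℝ[X]}
    (hL : IsLaguerreTypeII α n L) {x : ℝ} (hx : 0 < x) :
    ∃ (F : ℂ → ℂ) (c c' : ℂ),
      (∀ s ∈ Complex.slitPlane, HasDerivAt F (laguerreIntegrand α n x s) s) ∧
      ((L.eval x * Real.exp (-x) : ℝ) : ℂ) = (-1) ^ (∑ i, n i) * (c - c') ∧
      ∀ δ : ℝ, 0 < δ → Tendsto F (gammaTail δ) (𝓝 c) ∧
        Tendsto (fun s => F (starRingEnd ℂ s)) (gammaTail δ) (𝓝 c') := by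
  obtain ⟨F, c, c', hF, hc, hlim⟩ := exists_primitive_Gamma_mul_cpow_neg hx
  set K : ℂ := (-1) ^ (∑ i, n i) / (2 * Real.pi * Complex.I) with hK
  refine ⟨fun s => K * ∑ m ∈ L.support, (L.coeff m * (x : ℂ) ^ m) * F (s + m),
    K * ∑ m ∈ L.support, (L.coeff m * (x : ℂ) ^ m) * c,
    K * ∑ m ∈ L.support, (L.coeff m * (x : ℂ) ^ m) * c', ?_, ?_, ?_⟩
  · intro s hs
    rw [laguerreIntegrand_eq_sum hα hα' hL hx hs]
    refine (HasDerivAt.fun_sum fun m _ => HasDerivAt.const_mul _ ?_).const_mul K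
    refine (hF (s + m) ?_).comp_add_const s (m : ℂ)
    rw [Complex.mem_slitPlane_iff] at hs ⊢
    have : (0 : ℝ) ≤ m := m.cast_nonneg
    rcases hs with h | h
    · left; simp; linarith
    · right; simpa using h
  · rw [← mul_sub, ← Finset.sum_mul, ← Finset.sum_mul, ← mul_sub, hc, eval_eq_sum,
      Polynomial.sum, hK]
    have hpi : (Real.pi : ℂ) ≠ 0 := by exact_mod_cast Real.pi_ne_zero
    have hsq : ((-1 : ℂ) ^ (∑ i, n i)) * (-1) ^ (∑ i, n i) = 1 := by
      rw [← mul_pow]; norm_num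
    have h2 := Complex.two_pi_I_ne_zero
    push_cast
    generalize (∑ m ∈ L.support, (L.coeff m : ℂ) * (x : ℂ) ^ m) = S
    generalize (-1 : ℂ) ^ (∑ i, n i) = ε at hsq
    calc _ = (ε * ε) * (S * Complex.exp (-x)) := by rw [hsq, one_mul]
      _ = _ := by field_simp
  · intro δ hδ
    obtain ⟨h1, h2⟩ := hlim δ hδ
    refine ⟨(tendsto_finsetSum _ fun m _ =>
      (h1.comp (tendsto_add_natCast_gammaTail δ m)).const_mul _).const_mul K,
      (tendsto_finsetSum _ fun m _ => Tendsto.const_mul _ ?_).const_mul K⟩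
    refine (h2.comp (tendsto_add_natCast_gammaTail δ m)).congr fun s => ?_
    simp

/-! ### Evaluation of the contour integral -/

/-- A contour may approach the poles, but by the intermediate value theorem it keeps crossing lines
`Re s = -N - 1/2`, at distance at least `1/2` from all of them. If the integral converges, these
crossings suffice to identify its value. -/
theorem exists_seq_tendsto_gammaTail {g : ℝ → ℂ} (hg : Continuous g)
    (hre : Tendsto (fun t => (g t).re) atTop atBot) (him : ∀ᶠ t in atTop, 0 < (g t).im) :
    ∃ u : ℕ → ℝ, Tendsto u atTop atTop ∧ Tendsto (fun k => g (u k)) atTop (gammaTail (1 / 2)) := by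
  have key : ∀ k : ℕ, ∃ b : ℝ, (k : ℝ) ≤ b ∧ ∃ N : ℕ, k ≤ N ∧ (g b).re = -N - 1 / 2 := by
    intro k
    obtain ⟨M, hM⟩ := exists_nat_ge (-(g k).re)
    set N := max k M
    have hMN : (M : ℝ) ≤ N := by exact_mod_cast le_max_right k M
    obtain ⟨t, ht, htk⟩ := ((hre.eventually_le_atBot (-N - 1 / 2)).and
      (eventually_ge_atTop (k : ℝ))).exists
    obtain ⟨b, hb, hbe⟩ := intermediate_value_Icc' htk
      (Complex.continuous_re.comp hg).continuousOn
      (show (-N - 1 / 2 : ℝ) ∈ Set.Icc _ _ from ⟨ht, by simp only [Function.comp]; linarith⟩)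
    exact ⟨b, hb.1, N, le_max_left _ _, hbe⟩
  choose u hu N hN huN using key
  have hutop : Tendsto u atTop atTop := tendsto_atTop_mono hu tendsto_natCast_atTop_atTop
  refine ⟨u, hutop, tendsto_gammaTail_iff.2 ⟨hre.comp hutop, ?_⟩⟩
  filter_upwards [hutop.eventually him] with k hk
  refine ⟨hk, fun j => le_trans ?_ (Complex.abs_re_le_norm _)⟩
  rw [Complex.add_re, huN, Complex.natCast_re]
  rcases le_or_gt j (N k) with h | h
  · have : (j : ℝ) ≤ N k := by exact_mod_cast h
    rw [le_abs]; right; linarith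
  · have : (N k : ℝ) + 1 ≤ j := by exact_mod_cast h
    rw [le_abs]; left; linarith

theorem theorem3p4 {p : ℕ} (α : Fin p → ℝ) (hα : ∀ i, -1 < α i)
    (hα' : ∀ i j, i ≠ j → ∀ k : ℤ, α i - α j ≠ k)
    (n : Fin p → ℕ) (L : ℝ[X]) (hL : IsLaguerreTypeII α n L)
    (x : ℝ) (hx : 0 < x) (γ : ℝ → ℂ) (hγ : EnclosesNegHalfLineOnce γ) :
    -- the integral converges if the contour stays at a positive distance from `(-∞, 0]`
    ((∃ δ : ℝ, 0 < δ ∧ ∀ t r : ℝ, r ≤ 0 → δ ≤ ‖γ t - r‖) →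
      ∃ I : ℂ, HasContourIntegral γ (laguerreIntegrand α n x) I) ∧
    -- whenever it converges, it has the stated value
    ∀ I : ℂ, HasContourIntegral γ (laguerreIntegrand α n x) I →
      ((L.eval x * Real.exp (-x) : ℝ) : ℂ) = (-1) ^ (∑ i, n i) * I := by
  obtain ⟨F, c, c', hF, hval, hlim⟩ := exists_primitive_laguerreIntegrand hα hα' hL hx
  obtain ⟨hbot, htop⟩ := hγ.eventually_im
  obtain ⟨hp, hs, hrebot, hretop, -⟩ := hγ
  have hcont : ContinuousOn (laguerreIntegrand α n x) Complex.slitPlane := by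
    have hd : DifferentiableOn ℂ F Complex.slitPlane :=
      fun s hs => (hF s hs).differentiableAt.differentiableWithinAt
    exact (hd.deriv Complex.isOpen_slitPlane).continuousOn.congr fun s hs => (hF s hs).deriv.symm
  have hint := fun a b => hp.integral_eq_sub hs hcont hF a b
  refine ⟨?_, fun I hI => ?_⟩
  · rintro ⟨δ, hδ, hdist⟩
    obtain ⟨h1, h2⟩ := hlim δ hδ
    have hk : ∀ t, ∀ k : ℕ, δ ≤ ‖γ t + k‖ := fun t k => by
      simpa using hdist t (-k) (by simp)
    refine ⟨c - c', fun a b => hp.intervalIntegrable hs hcont a b, ?_⟩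
    simp only [hint]
    have e1 : Tendsto (fun t => F (γ t)) atTop (𝓝 c) :=
      h1.comp (tendsto_gammaTail_iff.2 ⟨hretop, htop.mono fun t ht => ⟨ht, hk t⟩⟩)
    have e2 : Tendsto (fun t => F (γ t)) atBot (𝓝 c') := by
      have e3 : Tendsto (fun t => starRingEnd ℂ (γ t)) atBot (gammaTail δ) := by
        refine tendsto_gammaTail_iff.2 ⟨by simpa using hrebot, hbot.mono fun t ht =>
          ⟨by simpa using ht, fun k => ?_⟩⟩
        rw [← Complex.norm_conj, map_add, Complex.conj_conj, Complex.conj_natCast]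
        exact hk t k
      exact (h2.comp e3).congr fun t => by simp
    exact (e1.comp tendsto_snd).sub (e2.comp tendsto_fst)
  · obtain ⟨h1, h2⟩ := hlim (1 / 2) (by norm_num)
    obtain ⟨u, hu, hu'⟩ := exists_seq_tendsto_gammaTail hp.1 hretop htop
    -- Reversing and conjugating `γ` turns its lower end into an upper end at `+∞`.
    obtain ⟨v, hv, hv'⟩ := exists_seq_tendsto_gammaTail (g := fun t => starRingEnd ℂ (γ (-t)))
      (Complex.continuous_conj.comp (hp.1.comp continuous_neg))
      (by simpa [Function.comp_def] using hrebot.comp tendsto_neg_atTop_atBot)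
      (by simpa using tendsto_neg_atTop_atBot.eventually hbot)
    have e1 := h1.comp hu'
    have e2 := h2.comp hv'
    have e3 := hI.2.comp ((tendsto_neg_atTop_atBot.comp hv).prodMk hu)
    rw [hval, tendsto_nhds_unique e3 ((e1.sub e2).congr fun k => ?_)]
    simp [hint]
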